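/- **Theorem (Minimax lower bound for invariant prediction errors).** Setting. Let $\mathcal E_{all}$ be a finite set of environments with weights $\alpha^*_e\ge 0$, $\sum_e\alpha^*_e=1$, and let $\mathcal E_{tr}\subseteq\mathcal E_{all}$ contain at least two training environments. Let $p\ge 2$. A family $\mathcal P=(P^e)_{e\in\mathcal E_{all}}$ consists of probability laws $P^e$ of $(x^e,y^e)\in\mathbb R^p\times\mathbb R$ with finite second moments; $R^e(b)=\mathbb E[(y^e-(x^e)^\top b)^2]$. A set $S\subseteq[p]$ is *invariant*, $S\in\mathcal S^*(\mathcal P)$, if for all $b\in\mathbb R^S$ the values $\mathbb E[b^\top x^e_S\,y^e]$ and $\mathbb E[(b^\top x^e_S)^2]$ do not depend on $e\in\mathcal E_{all}$. Let $\beta^*=\beta^*(\mathcal P)$ be any choice of a minimizer of $\sum_{e\in\mathcal E_{all}}\alpha^*_eR^e(b)$ over all $b\in\mathbb R^p$ whose support is contained in an invariant set. For $e\in\mathcal E_{tr}$ we observe $n_e$ independent draws from $P^e$, independent across environments, and $N_{tr}=\sum_{e\in\mathcal E_{tr}}n_e$. Let $\Xi(s,\rho,\sigma^2)$ be the set of families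 $\mathcal P$ such that for every $e\in\mathcal E_{all}$: $\mathbb E[\{\mathbb E[y^e|x^e]-(x^e)^\top\beta^*\}^2]\le\rho$ and $\mathrm{Var}(y^e|x^e)\le\sigma^2$ almost surely; $\|\beta^*\|_0\le s$; and (diversity) for every $S\notin\mathcal S^*(\mathcal P)$ there are $b\in\mathbb R^S$ and $e,e'\in\mathcal E_{tr}$ with $\mathbb E[b^\top x^e_Sy^e]\ne\mathbb E[b^\top x^{e'}_Sy^{e'}]$ or $\mathbb E[(b^\top x^e_S)^2]\neq\mathbb E[(b^\top x^{e'}_S)^2]$. Let $c_1,c_2,c_3,K>0$ with $c_2\le c_3$ and $c_2\le K$. The *model assumptions* are: for $e\in\mathcal E_{tr}$, $y^e$ and $x^e$ have mean zero, $y^e$ and $v^\top x^e$ ($\|v\|_2=1$) are sub-Gaussian with variance proxy $K$, and $\mathbb E[(y^e)^2]\le c_1$; with $\Sigma^e=\mathbb E[x^e(x^e)^\top]$, $\Lambda_{\min}(\Sigma^e)\ge c_2$ for $e\in\mathcal E_{tr}$, $\Lambda_{\max}(\Sigma^e)\le c_3$ for $e\in\mathcal E_{all}$, and $\Sigma^e_{j,j}=\Sigma^{e'}_{j,j}$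 for all $e,e'\in\mathcal E_{tr}$ and all $j$. For $b\in\mathbb R^p$ define the loss $$r(b,\mathcal P)=\begin{cases}\max_{e\in\mathcal E_{all}}\{R^e(b)-R^e(\beta^*)\}&\text{if }\mathrm{supp}(b)\in\mathcal S^*(\mathcal P),\\ \infty&\text{otherwise.}\end{cases}$$ Claim. For all $c>0$ and $B>0$ there is a constant $C>0$, depending only on $c,B,c_1,c_2,c_3,K$, such that whenever $3\le s\le cN_{tr}/\log p$, $\rho\ge1$ and $0<\sigma^2\le B$, $$\inf_{\hat\beta}\ \sup_{\mathcal P}\ \mathbb E_{\mathcal P}[r(\hat\beta,\mathcal P)]\ \ge\ C\,\frac{\sigma^2 s\log p}{N_{tr}}+\frac{C}{\sqrt{N_{tr}}},$$ where the infimum is over all estimators (measurable functions of the training data) and the supremum over all $\mathcal P\in\Xi(s,\rho,\sigma^2)$ satisfying the model assumptions. -/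

import Mathlib

open MeasureTheory ProbabilityTheory
open scoped ENNReal NNReal

noncomputable section

namespace Fairm

/-- An observation `(x, y)` with `p` features and a real outcome. -/
abbrev Obs (p : ℕ) : Type := (Fin p → ℝ) × ℝ

/-- A family `(P^e)` of joint laws of `(x^e, y^e)`, indexed by the set `E` of all environments. -/
abbrev EnvFamily (E : Type*) (p : ℕ) : Type _ := E → ProbabilityMeasure (Obs p)

variable {E : Type*} {p : ℕ}

/-- The linear rule `u ∘ Φ`, where `Φ(x) = x_S` and `u(φ) = φᵀ b`. -/
def linRule (S : Finset (Fin p)) (b : S → ℝ) (x : Fin p → ℝ) : ℝ := ∑ j : S, b j * x j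

/-- `max_{e, e' ∈ A} sup_u |𝔼[u(x_S^e) y^e] - 𝔼[u(x_S^{e'}) y^{e'}]|`. -/
def crossGap (P : EnvFamily E p) (A : Finset E) (S : Finset (Fin p)) : ℝ≥0∞ :=
  ⨆ e ∈ A, ⨆ e' ∈ A, ⨆ b : S → ℝ, ENNReal.ofReal
    |(∫ z, linRule S b z.1 * z.2 ∂(P e : Measure (Obs p)))
      - ∫ z, linRule S b z.1 * z.2 ∂(P e' : Measure (Obs p))|

/-- `max_{e, e' ∈ A} sup_u |𝔼[u(x_S^e)²] - 𝔼[u(x_S^{e'})²]|`. -/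
def momentGap (P : EnvFamily E p) (A : Finset E) (S : Finset (Fin p)) : ℝ≥0∞ :=
  ⨆ e ∈ A, ⨆ e' ∈ A, ⨆ b : S → ℝ, ENNReal.ofReal
    |(∫ z, linRule S b z.1 ^ 2 ∂(P e : Measure (Obs p)))
      - ∫ z, linRule S b z.1 ^ 2 ∂(P e' : Measure (Obs p))|

/-- The collection of feature sets `S` for which `x_S` is an invariant representation
over all environments. -/
def invariantSets [Fintype E] (P : EnvFamily E p) : Set (Finset (Fin p)) :=
  {S | crossGap P Finset.univ S = 0 ∧ momentGap P Finset.univ S = 0}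

/-- The diversity condition: every non-invariant representation is already seen to be
non-invariant on the training environments. -/
def Diversity [Fintype E] (tr : Finset E) (P : EnvFamily E p) : Prop :=
  ∀ S : Finset (Fin p), S ∉ invariantSets P → 0 < crossGap P tr S ∨ 0 < momentGap P tr S

/-- The support of a coefficient vector. -/
def supp (β : Fin p → ℝ) : Finset (Fin p) := {j | β j ≠ 0}

/-- The prediction risk `R^e(β) = 𝔼[(y^e - (x^e)ᵀ β)²]`. -/
def risk (P : EnvFamily E p) (e : E) (β : Fin p → ℝ) : ℝ :=
  ∫ z, (z.2 - z.1 ⬝ᵥ β) ^ 2 ∂(P e : Measure (Obs p))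

/-- The set of minimizers of `∑ₑ αₑ 𝔼[(y^e - (x^e)ᵀ β)²]` over all `β` that are supported on
some invariant set. -/
def oracleSolutions [Fintype E] (α : E → ℝ) (P : EnvFamily E p) : Set (Fin p → ℝ) :=
  {β | (∃ S ∈ invariantSets P, supp β ⊆ S) ∧
    ∀ S ∈ invariantSets P, ∀ b : Fin p → ℝ, supp b ⊆ S →
      ∑ e, α e * risk P e β ≤ ∑ e, α e * risk P e b}

/-- `βs` is a choice `P ↦ β*(P)` of a solution of the oracle problem (which may have several). -/
def IsOracle [Fintype E] (α : E → ℝ) (βs : EnvFamily E p → (Fin p → ℝ)) : Prop :=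
  ∀ P, (oracleSolutions α P).Nonempty → βs P ∈ oracleSolutions α P

/-- The σ-algebra on the space of observations that is generated by the features. -/
abbrev featureAlg (p : ℕ) : MeasurableSpace (Obs p) :=
  MeasurableSpace.comap Prod.fst inferInstance

/-- The parameter space `Ξ(s, ρ, σ²)`, where `σ2` stands for `σ²`. -/
structure MemXi [Fintype E] (tr : Finset E) (βs : EnvFamily E p → (Fin p → ℝ))
    (s : ℕ) (ρ σ2 : ℝ) (P : EnvFamily E p) : Prop where
  memLp_x : ∀ e j, MemLp (fun z : Obs p => z.1 j) 2 (P e : Measure (Obs p))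
  memLp_y : ∀ e, MemLp (fun z : Obs p => z.2) 2 (P e : Measure (Obs p))
  approx : ∀ e, ∫ z, (((P e : Measure (Obs p))[fun z : Obs p => z.2 | featureAlg p]) z
      - z.1 ⬝ᵥ βs P) ^ 2 ∂(P e : Measure (Obs p)) ≤ ρ
  condVar_le : ∀ e, ∀ᵐ z ∂(P e : Measure (Obs p)),
    (condVar (featureAlg p) (fun z : Obs p => z.2) (P e : Measure (Obs p))) z ≤ σ2
  diversity : Diversity tr P
  sparse : (supp (βs P)).card ≤ s

/-- The matrix `Σ^e = 𝔼[x^e (x^e)ᵀ]`; it is the covariance matrix when `x^e` is centred. -/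
def covMatrix (P : EnvFamily E p) (e : E) : Matrix (Fin p) (Fin p) ℝ :=
  Matrix.of fun j k => ∫ z, z.1 j * z.1 k ∂(P e : Measure (Obs p))

/-- The model assumptions: on the training environments the outcome and the features are centred
and sub-Gaussian (with variance proxy `K`, for the features in every direction), with bounded
second moments, well-conditioned covariance matrices and invariant feature variances. -/
structure ModelCondition (tr : Finset E) (c₁ c₂ c₃ : ℝ) (K : ℝ≥0) (P : EnvFamily E p) :
    Prop where
  mean_y : ∀ e ∈ tr, ∫ z, z.2 ∂(P e : Measure (Obs p)) = 0
  subG_y : ∀ e ∈ tr, HasSubgaussianMGF (fun z : Obs p => z.2) K (P e : Measure (Obs p))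
  moment_y : ∀ e ∈ tr, ∫ z, z.2 ^ 2 ∂(P e : Measure (Obs p)) ≤ c₁
  mean_x : ∀ e ∈ tr, ∀ j, ∫ z, z.1 j ∂(P e : Measure (Obs p)) = 0
  subG_x : ∀ e ∈ tr, ∀ v : Fin p → ℝ, v ⬝ᵥ v = 1 →
    HasSubgaussianMGF (fun z : Obs p => z.1 ⬝ᵥ v) K (P e : Measure (Obs p))
  eig_lower : ∀ e ∈ tr, ∀ t ∈ spectrum ℝ (covMatrix P e), c₂ ≤ t
  eig_upper : ∀ e, ∀ t ∈ spectrum ℝ (covMatrix P e), t ≤ c₃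
  diag_eq : ∀ e ∈ tr, ∀ e' ∈ tr, ∀ j, covMatrix P e j j = covMatrix P e' j j

open Classical in
/-- The loss `r(b, P)`: the worst excess risk over all environments if the support of `b` is an
invariant set, and `∞` otherwise. In the first case the excess risks are nonnegative for
`P` in the class considered, because `β*(P)` minimizes the risk among such vectors. -/
def loss [Fintype E] (βs : EnvFamily E p → (Fin p → ℝ)) (b : Fin p → ℝ) (P : EnvFamily E p) :
    ℝ≥0∞ :=
  if supp b ∈ invariantSets P then ⨆ e, ENNReal.ofReal (risk P e b - risk P e (βs P)) else ∞

/-- The training data: `n e` observations from each training environment `e`. -/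
abbrev Data (tr : Finset E) (n : E → ℕ) (p : ℕ) : Type _ := (e : tr) → Fin (n e) → Obs p

/-- The law of the training data: independent observations, those of environment `e` with
law `P e`. -/
def dataLaw (tr : Finset E) (n : E → ℕ) (P : EnvFamily E p) : Measure (Data tr n p) :=
  Measure.pi fun e : tr => Measure.pi fun _ : Fin (n e) => (P e : Measure (Obs p))

/-- The infimum over all estimators (measurable functions of the training data) of the supremum
of the expected loss over `P ∈ Ξ(s, ρ, σ²)` that satisfy the model assumptions. -/
def minimaxRisk [Fintype E] (tr : Finset E) (n : E → ℕ) (βs : EnvFamily E p → (Fin p → ℝ))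
    (s : ℕ) (ρ σ2 c₁ c₂ c₃ : ℝ) (K : ℝ≥0) : ℝ≥0∞ :=
  ⨅ (βhat : Data tr n p → (Fin p → ℝ)) (_ : Measurable βhat),
    ⨆ (P : EnvFamily E p) (_ : MemXi tr βs s ρ σ2 P ∧ ModelCondition tr c₁ c₂ c₃ K P),
      ∫⁻ D, loss βs (βhat D) P ∂(dataLaw tr n P)

end Fairm

end

/-!
The minimax risk is bounded below by a constant that depends on `c₁, c₂, K` only. Since
`s log p ≤ c N`, `σ² ≤ B` and `N ≥ 1`, the claimed rate is at most `C (B c + 1)`, so a constant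
lower bound is enough.

The constant comes from the cost of selecting an invariant set, by Le Cam's two-point method. Let
`x` be uniform on `{√c₂, -√c₂}^p`: it is isotropic and sub-Gaussian with variance proxy exactly
`c₂`, so all the assumptions on the features hold even if `c₂ = c₃ = K`. Fix two features `i` and
`k`, and let `y = κ (x_i + x_k)` in every environment, except that in one training environment the
coefficient of `x_k` is `κ + η` for a small fraction `τ` of the population, independently of `x`
(`hardFamily`). However small `τ` and `η` are, this makes the sets that contain `k` non-invariant
(`mem_invariantSets_hardFamily`), and the only oracle solution is `κ` times the `i`-th unit vector
(`oracle_hardFamily`). The conditional variance of `y` is at most `c₂ η²`, which fits any noise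
level.

The second hypothesis exchanges `i` and `k`. A vector with `b_i = 0` has excess risk at least
`c₂ κ²`, or a non-invariant support, under the first hypothesis; a vector with `b_i ≠ 0` has a
non-invariant support under the second one (`le_loss_hardFamily`). On the other hand, with
`τ = 1 / (2 N)` the two laws of the data both dominate half of the law of uncontaminated data
(`smul_pi_linLaw_le_dataLaw`), so no estimator does well under both (`le_minimaxRisk`). The argument
needs only that the loss at a non-invariant support is at least `c₂ κ²`, not that it is infinite.
-/

namespace Fairm

/-! ### Rademacher features and mixtures of linear models -/

section Laws

variable {p : ℕ}

/-- The law of a fair coin. -/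
noncomputable def coin : Measure Bool := (2⁻¹ : ℝ≥0∞) • Measure.dirac true + (2⁻¹ : ℝ≥0∞) • Measure.dirac false

instance : IsProbabilityMeasure coin := ⟨by simp [coin, ENNReal.inv_two_add_inv_two]⟩

lemma integral_coin (f : Bool → ℝ) : ∫ b, f b ∂coin = (f true + f false) / 2 := by
  rw [coin, integral_add_measure (Integrable.of_finite.smul_measure (by simp))
    (Integrable.of_finite.smul_measure (by simp)), integral_smul_measure, integral_smul_measure,
    integral_dirac, integral_dirac]
  simp
  ring

/-- The law of `p` independent fair coins. -/
noncomputable def coins (p : ℕ) : Measure (Fin p → Bool) := Measure.pi fun _ => coin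

instance : IsProbabilityMeasure (coins p) := by unfold coins; infer_instance

/-- The feature vector in `{a, -a}^p` that is encoded by a sequence of coin tosses. -/
def signVec (a : ℝ) (ω : Fin p → Bool) : Fin p → ℝ := fun j => if ω j then a else -a

lemma integral_signVec (a : ℝ) (j : Fin p) : ∫ ω, signVec a ω j ∂coins p = 0 := by
  have := integral_comp_eval (μ := fun _ : Fin p => coin) (i := j)
    (f := fun b : Bool => if b then a else -a) .of_discrete
  simpa [coins, signVec, integral_coin] using this

lemma integral_signVec_mul (a : ℝ) (j k : Fin p) :
    ∫ ω, signVec a ω j * signVec a ω k ∂coins p = if j = k then a ^ 2 else 0 := by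
  split_ifs with h
  · subst h
    have : ∀ ω : Fin p → Bool, signVec a ω j * signVec a ω j = a ^ 2 := by
      intro ω
      unfold signVec
      split_ifs <;> ring
    simp [this]
  · have hind : iIndepFun (fun (i : Fin p) (ω : Fin p → Bool) => if ω i then a else -a)
        (Measure.pi fun _ => coin) :=
      iIndepFun_pi (X := fun _ (b : Bool) => if b then a else -a) fun _ => Measurable.of_discrete.aemeasurable
    have := (hind.indepFun h).integral_mul_eq_mul_integral (by fun_prop) (by fun_prop)
    have h0 := integral_signVec a j
    simp only [signVec, coins, Pi.mul_apply] at this h0 ⊢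
    rw [this, h0, zero_mul]

lemma integral_signVec_dotProduct_mul (a : ℝ) (u v : Fin p → ℝ) :
    ∫ ω, (signVec a ω ⬝ᵥ u) * (signVec a ω ⬝ᵥ v) ∂coins p = a ^ 2 * (u ⬝ᵥ v) := by
  have h : ∀ ω : Fin p → Bool, (signVec a ω ⬝ᵥ u) * (signVec a ω ⬝ᵥ v)
      = ∑ j, ∑ k, (u j * v k) * (signVec a ω j * signVec a ω k) := by
    intro ω
    simp only [dotProduct, Finset.sum_mul_sum]
    exact Finset.sum_congr rfl fun j _ => Finset.sum_congr rfl fun k _ => by ring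
  simp_rw [h]
  rw [integral_finsetSum _ fun _ _ => Integrable.of_finite]
  simp_rw [integral_finsetSum _ fun _ _ => (Integrable.of_finite : Integrable _ (coins p)),
    integral_const_mul, integral_signVec_mul]
  simp [dotProduct, Finset.mul_sum]
  exact Finset.sum_congr rfl fun j _ => by ring

/-- Isotropic Rademacher vectors are sub-Gaussian with the optimal variance proxy, by
`cosh t ≤ exp (t² / 2)`. -/
lemma integral_exp_signVec_dotProduct_le (a t : ℝ) (v : Fin p → ℝ) :
    ∫ ω, Real.exp (t * (signVec a ω ⬝ᵥ v)) ∂coins p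
      ≤ Real.exp (a ^ 2 * (v ⬝ᵥ v) * t ^ 2 / 2) := by
  have h : ∀ ω : Fin p → Bool, Real.exp (t * (signVec a ω ⬝ᵥ v))
      = ∏ j, Real.exp (t * ((if ω j then a else -a) * v j)) := by
    intro ω
    rw [← Real.exp_sum, dotProduct, Finset.mul_sum]
    rfl
  have h2 : a ^ 2 * (v ⬝ᵥ v) * t ^ 2 / 2 = ∑ j, (t * (a * v j)) ^ 2 / 2 := by
    simp only [dotProduct, Finset.mul_sum, Finset.sum_mul, Finset.sum_div]
    exact Finset.sum_congr rfl fun j _ => by ring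
  simp_rw [h]
  rw [coins, integral_fintype_prod_eq_prod
    (f := fun (j : Fin p) (b : Bool) => Real.exp (t * ((if b then a else -a) * v j))), h2,
    Real.exp_sum]
  refine Finset.prod_le_prod (fun j _ => integral_nonneg fun _ => (Real.exp_pos _).le) fun j _ => ?_
  rw [integral_coin]
  refine le_trans (le_of_eq ?_) (Real.cosh_le_exp_half_sq _)
  rw [Real.cosh_eq]
  simp

/-- The observation `(x, xᵀ β)` whose features are encoded by coin tosses. -/
def linObs (a : ℝ) (β : Fin p → ℝ) (ω : Fin p → Bool) : Obs p :=
  (signVec a ω, signVec a ω ⬝ᵥ β)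

/-- The law of `(x, xᵀ β)` for `x` uniform on `{a, -a}^p`. -/
noncomputable def linLaw (a : ℝ) (β : Fin p → ℝ) : Measure (Obs p) := (coins p).map (linObs a β)

instance (a : ℝ) (β : Fin p → ℝ) : IsProbabilityMeasure (linLaw a β) :=
  Measure.isProbabilityMeasure_map Measurable.of_discrete.aemeasurable

/-- The mixture of two linear models that share the law of the features: the coefficient vector
is `γ` with probability `τ` and `β` otherwise, independently of the features. -/
noncomputable def mixLaw (a : ℝ) (τ : unitInterval) (β γ : Fin p → ℝ) : ProbabilityMeasure (Obs p) :=
  ⟨ENNReal.ofReal (1 - τ) • linLaw a β + ENNReal.ofReal τ • linLaw a γ, ⟨by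
    simp [← ENNReal.ofReal_add (sub_nonneg.2 τ.2.2) τ.2.1]⟩⟩

variable {a : ℝ} {τ : unitInterval} {β γ : Fin p → ℝ}

lemma coe_mixLaw : (mixLaw a τ β γ : Measure (Obs p))
    = ENNReal.ofReal (1 - τ) • linLaw a β + ENNReal.ofReal τ • linLaw a γ := rfl

lemma smul_linLaw_le_mixLaw :
    ENNReal.ofReal (1 - τ) • linLaw a β ≤ (mixLaw a τ β γ : Measure (Obs p)) :=
  Measure.le_add_right le_rfl

lemma integrable_linLaw {F : Obs p → ℝ} (hF : Measurable F) : Integrable F (linLaw a β) :=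
  (integrable_map_measure hF.aestronglyMeasurable Measurable.of_discrete.aemeasurable).2
    Integrable.of_finite

lemma integrable_mixLaw {F : Obs p → ℝ} (hF : Measurable F) :
    Integrable F (mixLaw a τ β γ : Measure (Obs p)) :=
  ((integrable_linLaw hF).smul_measure (by simp)).add_measure
    ((integrable_linLaw hF).smul_measure (by simp))

lemma integral_mixLaw {F : Obs p → ℝ} (hF : Measurable F) :
    ∫ z, F z ∂(mixLaw a τ β γ : Measure (Obs p))
      = (1 - τ) * ∫ ω, F (linObs a β ω) ∂coins p + τ * ∫ ω, F (linObs a γ ω) ∂coins p := by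
  rw [coe_mixLaw, integral_add_measure ((integrable_linLaw hF).smul_measure (by simp))
    ((integrable_linLaw hF).smul_measure (by simp)), integral_smul_measure, integral_smul_measure,
    linLaw, linLaw, integral_map Measurable.of_discrete.aemeasurable hF.aestronglyMeasurable,
    integral_map Measurable.of_discrete.aemeasurable hF.aestronglyMeasurable,
    ENNReal.toReal_ofReal (sub_nonneg.2 τ.2.2), ENNReal.toReal_ofReal τ.2.1]
  rfl

lemma integral_mixLaw_features {F : (Fin p → ℝ) → ℝ} (hF : Measurable F) :
    ∫ z, F z.1 ∂(mixLaw a τ β γ : Measure (Obs p)) = ∫ ω, F (signVec a ω) ∂coins p := by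
  rw [integral_mixLaw (F := fun z => F z.1) (by fun_prop)]
  simp only [linObs]
  ring

lemma ae_mixLaw {q : Obs p → Prop} (hq : MeasurableSet {z | q z})
    (h : ∀ ω, q (linObs a β ω) ∧ q (linObs a γ ω)) :
    ∀ᵐ z ∂(mixLaw a τ β γ : Measure (Obs p)), q z := by
  have hlin : ∀ b : Fin p → ℝ, (∀ ω, q (linObs a b ω)) → ∀ᵐ z ∂linLaw a b, q z := fun b hb =>
    (ae_map_iff Measurable.of_discrete.aemeasurable hq).2 (.of_forall hb)
  rw [coe_mixLaw, ae_add_measure_iff]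
  exact ⟨Measure.ae_smul_measure (hlin β fun ω => (h ω).1) _,
    Measure.ae_smul_measure (hlin γ fun ω => (h ω).2) _⟩

lemma memLp_two_mixLaw {F : Obs p → ℝ} (hF : Measurable F) :
    MemLp F 2 (mixLaw a τ β γ : Measure (Obs p)) :=
  (memLp_two_iff_integrable_sq hF.aestronglyMeasurable).2 (integrable_mixLaw (hF.pow_const 2))

@[fun_prop]
lemma measurable_dotProduct_const (u : Fin p → ℝ) : Measurable fun x : Fin p → ℝ => x ⬝ᵥ u := by
  unfold dotProduct
  fun_prop

lemma integral_features_mul_features (u v : Fin p → ℝ) :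
    ∫ z, (z.1 ⬝ᵥ u) * (z.1 ⬝ᵥ v) ∂(mixLaw a τ β γ : Measure (Obs p)) = a ^ 2 * (u ⬝ᵥ v) := by
  rw [integral_mixLaw_features (F := fun x => (x ⬝ᵥ u) * (x ⬝ᵥ v)) (by fun_prop),
    integral_signVec_dotProduct_mul]

lemma integral_features_mul_outcome (u : Fin p → ℝ) :
    ∫ z, (z.1 ⬝ᵥ u) * z.2 ∂(mixLaw a τ β γ : Measure (Obs p))
      = a ^ 2 * (u ⬝ᵥ ((1 - τ : ℝ) • β + (τ : ℝ) • γ)) := by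
  rw [integral_mixLaw (F := fun z => (z.1 ⬝ᵥ u) * z.2) (by fun_prop)]
  simp only [linObs, integral_signVec_dotProduct_mul, dotProduct_add, dotProduct_smul, smul_eq_mul]
  ring

lemma integral_sq_residual (b : Fin p → ℝ) :
    ∫ z, (z.2 - z.1 ⬝ᵥ b) ^ 2 ∂(mixLaw a τ β γ : Measure (Obs p))
      = a ^ 2 * ((1 - τ) * ((β - b) ⬝ᵥ (β - b)) + τ * ((γ - b) ⬝ᵥ (γ - b))) := by
  rw [integral_mixLaw (F := fun z => (z.2 - z.1 ⬝ᵥ b) ^ 2) (by fun_prop)]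
  simp only [linObs, ← dotProduct_sub, pow_two (_ ⬝ᵥ _), integral_signVec_dotProduct_mul]
  ring

lemma integral_signVec_dotProduct (v : Fin p → ℝ) : ∫ ω, signVec a ω ⬝ᵥ v ∂coins p = 0 := by
  simp only [dotProduct]
  rw [integral_finsetSum _ fun _ _ => Integrable.of_finite]
  simp [integral_mul_const, integral_signVec]

lemma hasSubgaussianMGF_features {v : Fin p → ℝ} {K : ℝ≥0} (hv : a ^ 2 * (v ⬝ᵥ v) ≤ K) :
    HasSubgaussianMGF (fun z : Obs p => z.1 ⬝ᵥ v) K (mixLaw a τ β γ : Measure (Obs p)) where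
  integrable_exp_mul t := integrable_mixLaw (by fun_prop)
  mgf_le t := by
    rw [mgf, integral_mixLaw_features (F := fun x => Real.exp (t * (x ⬝ᵥ v))) (by fun_prop)]
    refine (integral_exp_signVec_dotProduct_le a t v).trans ?_
    gcongr

lemma hasSubgaussianMGF_outcome {K : ℝ≥0} (hβ : a ^ 2 * (β ⬝ᵥ β) ≤ K)
    (hγ : a ^ 2 * (γ ⬝ᵥ γ) ≤ K) :
    HasSubgaussianMGF (fun z : Obs p => z.2) K (mixLaw a τ β γ : Measure (Obs p)) where
  integrable_exp_mul t := integrable_mixLaw (by fun_prop)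
  mgf_le t := by
    have key : ∀ b : Fin p → ℝ, a ^ 2 * (b ⬝ᵥ b) ≤ K →
        ∫ ω, Real.exp (t * (linObs a b ω).2) ∂coins p ≤ Real.exp (K * t ^ 2 / 2) := by
      intro b hb
      refine (integral_exp_signVec_dotProduct_le a t b).trans ?_
      gcongr
    rw [mgf, integral_mixLaw (F := fun z => Real.exp (t * z.2)) (by fun_prop)]
    have h1 := mul_le_mul_of_nonneg_left (key β hβ) (sub_nonneg.2 τ.2.2)
    have h2 := mul_le_mul_of_nonneg_left (key γ hγ) τ.2.1
    linarith

lemma featureAlg_le : featureAlg p ≤ (inferInstance : MeasurableSpace (Obs p)) :=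
  measurable_fst.comap_le

/-- The regression function of a mixture of two linear models with the same feature law is linear,
with the averaged coefficient vector. -/
lemma condExp_outcome :
    ((mixLaw a τ β γ : Measure (Obs p))[fun z : Obs p => z.2 | featureAlg p])
      =ᵐ[(mixLaw a τ β γ : Measure (Obs p))]
        fun z => z.1 ⬝ᵥ ((1 - τ : ℝ) • β + (τ : ℝ) • γ) := by
  refine (ae_eq_condExp_of_forall_setIntegral_eq featureAlg_le
    (integrable_mixLaw measurable_snd) (fun s _ _ => (integrable_mixLaw (by fun_prop)).integrableOn)
    ?_ ?_).symm
  · rintro s ⟨A, hA, rfl⟩ -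
    have hA' : MeasurableSet (Prod.fst ⁻¹' A : Set (Obs p)) := measurable_fst hA
    rw [← integral_indicator hA', ← integral_indicator hA',
      integral_mixLaw ((by fun_prop : Measurable fun z : Obs p => z.1 ⬝ᵥ _).indicator hA'),
      integral_mixLaw (measurable_snd.indicator hA'), ← integral_const_mul, ← integral_const_mul,
      ← integral_const_mul, ← integral_const_mul,
      ← integral_add Integrable.of_finite Integrable.of_finite,
      ← integral_add Integrable.of_finite Integrable.of_finite]
    refine integral_congr_ae (.of_forall fun ω => ?_)
    by_cases hω : signVec a ω ∈ A
    · simp [linObs, Set.indicator, hω]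
      ring
    · simp [linObs, Set.indicator, hω]
  · have h1 : Measurable[featureAlg p] (Prod.fst : Obs p → Fin p → ℝ) := comap_measurable _
    exact ((measurable_dotProduct_const _).comp h1).stronglyMeasurable.aestronglyMeasurable

/-- The conditional variance of the outcome is controlled by the gap between the two linear
models. -/
lemma condVar_outcome_le {v : ℝ} (hv : ∀ ω, (signVec a ω ⬝ᵥ (γ - β)) ^ 2 ≤ v) :
    ∀ᵐ z ∂(mixLaw a τ β γ : Measure (Obs p)),
      condVar (featureAlg p) (fun z : Obs p => z.2) (mixLaw a τ β γ : Measure (Obs p)) z ≤ v := by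
  set μ := (mixLaw a τ β γ : Measure (Obs p))
  set m := (1 - τ : ℝ) • β + (τ : ℝ) • γ with hm
  have hτ0 : (0 : ℝ) ≤ τ := τ.2.1
  have hτ1 : (τ : ℝ) ≤ 1 := τ.2.2
  have hres : ∀ᵐ z ∂μ, (z.2 - z.1 ⬝ᵥ m) ^ 2 ≤ v := by
    refine ae_mixLaw (measurableSet_le (by fun_prop) measurable_const) fun ω => ?_
    have e1 : β - m = (-(τ : ℝ)) • (γ - β) := by rw [hm]; module
    have e2 : γ - m = (1 - τ : ℝ) • (γ - β) := by rw [hm]; module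
    simp only [linObs, ← dotProduct_sub, e1, e2, dotProduct_smul, smul_eq_mul, mul_pow]
    have h0 := sq_nonneg (signVec a ω ⬝ᵥ (γ - β))
    exact ⟨(mul_le_of_le_one_left h0 (by nlinarith)).trans (hv ω),
      (mul_le_of_le_one_left h0 (by nlinarith)).trans (hv ω)⟩
  have hsq : (((fun z : Obs p => z.2) - μ[fun z : Obs p => z.2 | featureAlg p]) ^ 2)
      =ᵐ[μ] fun z => (z.2 - z.1 ⬝ᵥ m) ^ 2 := by
    filter_upwards [condExp_outcome (a := a) (τ := τ) (β := β) (γ := γ)] with z hz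
    simp [μ, m, hz]
  have hle := condExp_mono (m := featureAlg p) (integrable_mixLaw (by fun_prop))
    (integrable_const v) hres
  rw [condExp_const featureAlg_le] at hle
  filter_upwards [condExp_congr_ae (m := featureAlg p) hsq, hle] with z h1 h2
  rw [condVar, h1]
  exact h2

end Laws

/-! ### Le Cam's two-point argument -/

section Comparison

/-- Domination of measures tensorizes. -/
lemma smul_pi_le_pi {ι : Type*} [Fintype ι] {X : ι → Type*} [∀ i, MeasurableSpace (X i)]
    {μ ν : ∀ i, Measure (X i)} [∀ i, SigmaFinite (μ i)] {r : ι → ℝ≥0∞}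
    (h : ∀ i, r i • μ i ≤ ν i) : (∏ i, r i) • Measure.pi μ ≤ Measure.pi ν := by
  have hle : ((∏ i, r i) • Measure.pi μ).toOuterMeasure
      ≤ OuterMeasure.pi fun i => (ν i).toOuterMeasure := by
    rw [OuterMeasure.le_pi]
    intro s _
    change (∏ i, r i) * Measure.pi μ (Set.univ.pi s) ≤ ∏ i, ν i (s i)
    rw [Measure.pi_pi, ← Finset.prod_mul_distrib]
    exact Finset.prod_le_prod' fun i _ => h i (s i)
  intro s
  conv_rhs => rw [Measure.pi]
  exact (hle s).trans (le_toMeasure_apply _ _ s)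

/-- Le Cam's two-point argument: if two laws dominate a multiple `q` of a common probability law
`ν`, then two losses that cannot both be small have a large total expectation. -/
lemma mul_le_lintegral_add_lintegral {Ω : Type*} [MeasurableSpace Ω] {ν μ₁ μ₂ : Measure Ω}
    [IsProbabilityMeasure ν] {q δ : ℝ≥0∞} (h₁ : q • ν ≤ μ₁) (h₂ : q • ν ≤ μ₂)
    {f₁ f₂ : Ω → ℝ≥0∞} {A : Set Ω} (hA : MeasurableSet A) (hf₁ : ∀ ω ∈ A, δ ≤ f₁ ω)
    (hf₂ : ∀ ω ∉ A, δ ≤ f₂ ω) :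
    q * δ ≤ ∫⁻ ω, f₁ ω ∂μ₁ + ∫⁻ ω, f₂ ω ∂μ₂ := by
  have key : ∀ {μ : Measure Ω} {f : Ω → ℝ≥0∞} {S : Set Ω}, MeasurableSet S → q • ν ≤ μ →
      (∀ ω ∈ S, δ ≤ f ω) → q * (δ * ν S) ≤ ∫⁻ ω, f ω ∂μ := by
    intro μ f S hS hμ hf
    calc q * (δ * ν S) = ∫⁻ ω, S.indicator (fun _ => δ) ω ∂(q • ν) := by
          rw [lintegral_smul_measure, lintegral_indicator_const hS, smul_eq_mul]
      _ ≤ ∫⁻ ω, f ω ∂μ := lintegral_mono' hμ fun ω => Set.indicator_le (fun ω hω => hf ω hω) ω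
  calc q * δ = q * (δ * ν A) + q * (δ * ν Aᶜ) := by
        rw [← mul_add, ← mul_add, measure_add_measure_compl hA, measure_univ, mul_one]
    _ ≤ _ := add_le_add (key hA h₁ hf₁) (key hA.compl h₂ hf₂)

end Comparison

/-! ### Families with one invariant and one non-invariant active feature -/

section HardFamily

variable {E : Type*} {p : ℕ}

lemma linRule_eq_dotProduct (S : Finset (Fin p)) (b : S → ℝ) (x : Fin p → ℝ) :
    linRule S b x = x ⬝ᵥ fun j => if h : j ∈ S then b ⟨j, h⟩ else 0 := by
  rw [linRule, dotProduct, ← Finset.sum_subset (Finset.subset_univ S)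
    (fun j _ hj => by simp [hj]), ← Finset.sum_coe_sort S]
  exact Finset.sum_congr rfl fun j _ => by simp [mul_comm]

lemma crossGap_eq_zero_iff {P : EnvFamily E p} {A : Finset E} {S : Finset (Fin p)} :
    crossGap P A S = 0 ↔ ∀ e ∈ A, ∀ e' ∈ A, ∀ b : S → ℝ,
      (∫ z, linRule S b z.1 * z.2 ∂(P e : Measure (Obs p)))
        = ∫ z, linRule S b z.1 * z.2 ∂(P e' : Measure (Obs p)) := by
  simp [crossGap, ENNReal.iSup_eq_zero, ENNReal.ofReal_eq_zero, sub_eq_zero]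

lemma momentGap_eq_zero_iff {P : EnvFamily E p} {A : Finset E} {S : Finset (Fin p)} :
    momentGap P A S = 0 ↔ ∀ e ∈ A, ∀ e' ∈ A, ∀ b : S → ℝ,
      (∫ z, linRule S b z.1 ^ 2 ∂(P e : Measure (Obs p)))
        = ∫ z, linRule S b z.1 ^ 2 ∂(P e' : Measure (Obs p)) := by
  simp [momentGap, ENNReal.iSup_eq_zero, ENNReal.ofReal_eq_zero, sub_eq_zero]

/-- The coefficient vector with entries `κ` at `i` and `θ` at `k`. -/
noncomputable def pairCoef (κ θ : ℝ) (i k : Fin p) : Fin p → ℝ := Pi.single i κ + Pi.single k θ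

lemma pairCoef_comm (κ : ℝ) (i k : Fin p) : pairCoef κ κ i k = pairCoef κ κ k i := add_comm _ _

open Classical in
/-- A family in which all environments follow the linear model with coefficient `κ` at `i` and `k`,
except that in environment `e₀` a fraction `τ` of the population has coefficient `κ + η` at `k`.
The feature `i` is invariant, the feature `k` is not. -/
noncomputable def hardFamily (a : ℝ) (τ : unitInterval) (κ η : ℝ) (e₀ : E) (i k : Fin p) :
    EnvFamily E p :=
  fun e => mixLaw a τ (pairCoef κ κ i k) (pairCoef κ (if e = e₀ then κ + η else κ) i k)

variable {a κ η : ℝ} {τ : unitInterval} {e₀ : E} {i k : Fin p}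

open Classical in
lemma integral_linRule_mul_hardFamily (e : E) (S : Finset (Fin p)) (b : S → ℝ) :
    ∫ z, linRule S b z.1 * z.2 ∂(hardFamily a τ κ η e₀ i k e : Measure (Obs p))
      = a ^ 2 * ((if h : i ∈ S then b ⟨i, h⟩ else 0) * κ
        + (if h : k ∈ S then b ⟨k, h⟩ else 0) * (κ + if e = e₀ then τ * η else 0)) := by
  simp_rw [linRule_eq_dotProduct, hardFamily, integral_features_mul_outcome, pairCoef,
    dotProduct_add, dotProduct_smul, dotProduct_add, dotProduct_single, smul_eq_mul]
  split_ifs <;> ring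

lemma integral_linRule_sq_hardFamily (e : E) (S : Finset (Fin p)) (b : S → ℝ) :
    ∫ z, linRule S b z.1 ^ 2 ∂(hardFamily a τ κ η e₀ i k e : Measure (Obs p))
      = a ^ 2 * ((fun j => if h : j ∈ S then b ⟨j, h⟩ else 0) ⬝ᵥ
        fun j => if h : j ∈ S then b ⟨j, h⟩ else 0) := by
  simp_rw [linRule_eq_dotProduct, pow_two (_ ⬝ᵥ _), hardFamily, integral_features_mul_features]

lemma momentGap_hardFamily (A : Finset E) (S : Finset (Fin p)) :
    momentGap (hardFamily a τ κ η e₀ i k) A S = 0 :=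
  momentGap_eq_zero_iff.2 fun e _ e' _ b => by simp_rw [integral_linRule_sq_hardFamily]

lemma crossGap_hardFamily_of_notMem (A : Finset E) {S : Finset (Fin p)} (hk : k ∉ S) :
    crossGap (hardFamily a τ κ η e₀ i k) A S = 0 :=
  crossGap_eq_zero_iff.2 fun e _ e' _ b => by
    simp only [integral_linRule_mul_hardFamily, dif_neg hk, zero_mul]

lemma crossGap_hardFamily_ne_zero (ha : 0 < a) (hη : 0 < η) (hτ : (0 : ℝ) < τ) (hik : i ≠ k)
    {e₁ : E} (he : e₁ ≠ e₀) {A : Finset E} (h₀ : e₀ ∈ A) (h₁ : e₁ ∈ A) {S : Finset (Fin p)}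
    (hk : k ∈ S) : crossGap (hardFamily a τ κ η e₀ i k) A S ≠ 0 := by
  intro h
  have := crossGap_eq_zero_iff.1 h e₀ h₀ e₁ h₁ (fun j => if (j : Fin p) = k then 1 else 0)
  simp [integral_linRule_mul_hardFamily, hk, hik, he, ha.ne', hη.ne'] at this
  exact hτ.ne' (by simp [this])

lemma mem_invariantSets_hardFamily [Fintype E] (ha : 0 < a) (hη : 0 < η) (hτ : (0 : ℝ) < τ)
    (hik : i ≠ k) {e₁ : E} (he : e₁ ≠ e₀) {S : Finset (Fin p)} :
    S ∈ invariantSets (hardFamily a τ κ η e₀ i k) ↔ k ∉ S := by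
  refine ⟨fun h hk => ?_, fun hk => ⟨crossGap_hardFamily_of_notMem _ hk, momentGap_hardFamily _ _⟩⟩
  exact crossGap_hardFamily_ne_zero ha hη hτ hik he (Finset.mem_univ _) (Finset.mem_univ _) hk h.1

lemma dotProduct_self_add_single {u : Fin p → ℝ} (hu : u k = 0) (θ : ℝ) :
    (u + Pi.single k θ) ⬝ᵥ (u + Pi.single k θ) = u ⬝ᵥ u + θ ^ 2 := by
  simp [add_dotProduct, dotProduct_add, hu, pow_two]

open Classical in
lemma risk_hardFamily (hik : i ≠ k) (e : E) {b : Fin p → ℝ} (hb : b k = 0) :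
    risk (hardFamily a τ κ η e₀ i k) e b
      = a ^ 2 * ((Pi.single i κ - b) ⬝ᵥ (Pi.single i κ - b))
        + a ^ 2 * ((1 - τ) * κ ^ 2 + τ * (if e = e₀ then κ + η else κ) ^ 2) := by
  have h : ∀ θ : ℝ, (pairCoef κ θ i k - b) ⬝ᵥ (pairCoef κ θ i k - b)
      = (Pi.single i κ - b) ⬝ᵥ (Pi.single i κ - b) + θ ^ 2 := by
    intro θ
    rw [← dotProduct_self_add_single (k := k) (by simp [hb, hik.symm]), pairCoef,
      add_sub_right_comm]
  rw [risk, hardFamily, integral_sq_residual, h, h]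
  ring

/-- The risks of two vectors that avoid the non-invariant feature differ by the same amount in all
environments. -/
lemma risk_sub_risk_hardFamily (hik : i ≠ k) (e : E) {b : Fin p → ℝ} (hb : b k = 0) :
    risk (hardFamily a τ κ η e₀ i k) e b - risk (hardFamily a τ κ η e₀ i k) e (Pi.single i κ)
      = a ^ 2 * ((Pi.single i κ - b) ⬝ᵥ (Pi.single i κ - b)) := by
  rw [risk_hardFamily hik e hb, risk_hardFamily hik e (by simp [hik.symm])]
  simp

lemma dotProduct_self_nonneg_real (u : Fin p → ℝ) : 0 ≤ u ⬝ᵥ u :=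
  Finset.sum_nonneg fun _ _ => mul_self_nonneg _

lemma notMem_supp {b : Fin p → ℝ} : k ∉ supp b ↔ b k = 0 := by simp [supp]

/-- The oracle problem of the hard family has exactly one solution, supported on `{i}`. -/
lemma oracle_hardFamily [Fintype E] (ha : 0 < a) (hη : 0 < η) (hτ : (0 : ℝ) < τ)
    (hik : i ≠ k) {e₁ : E} (he : e₁ ≠ e₀) {α : E → ℝ} (hα : ∑ e, α e = 1)
    {βs : EnvFamily E p → Fin p → ℝ} (hβs : IsOracle α βs) :
    βs (hardFamily a τ κ η e₀ i k) = Pi.single i κ := by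
  set P := hardFamily a τ κ η e₀ i k with hP
  have hinv : ∀ {S}, S ∈ invariantSets P ↔ k ∉ S := mem_invariantSets_hardFamily ha hη hτ hik he
  have hdiff : ∀ b : Fin p → ℝ, b k = 0 → ∑ e, α e * risk P e b
      = ∑ e, α e * risk P e (Pi.single i κ)
        + a ^ 2 * ((Pi.single i κ - b) ⬝ᵥ (Pi.single i κ - b)) := by
    intro b hb
    rw [← one_mul (a ^ 2 * _), ← hα, Finset.sum_mul, ← Finset.sum_add_distrib]
    refine Finset.sum_congr rfl fun e _ => ?_
    rw [← risk_sub_risk_hardFamily (τ := τ) (η := η) (e₀ := e₀) hik e hb, ← hP]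
    ring
  have hnonneg : ∀ b : Fin p → ℝ, 0 ≤ a ^ 2 * ((Pi.single i κ - b) ⬝ᵥ (Pi.single i κ - b)) :=
    fun b => mul_nonneg (sq_nonneg a) (dotProduct_self_nonneg_real _)
  have hk : ∀ {S} {b : Fin p → ℝ}, S ∈ invariantSets P → supp b ⊆ S → b k = 0 :=
    fun hS hb => notMem_supp.1 fun h => hinv.1 hS (hb h)
  have hsupp : supp (Pi.single i κ : Fin p → ℝ) ∈ invariantSets P :=
    hinv.2 (notMem_supp.2 (by simp [hik.symm]))
  have hmem : (Pi.single i κ : Fin p → ℝ) ∈ oracleSolutions α P := by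
    refine ⟨⟨_, hsupp, subset_rfl⟩, fun S hS b hb => ?_⟩
    rw [hdiff b (hk hS hb)]
    linarith [hnonneg b]
  obtain ⟨⟨S, hS, hsub⟩, hmin⟩ := hβs P ⟨_, hmem⟩
  have hle := hmin _ hsupp _ subset_rfl
  rw [hdiff _ (hk hS hsub)] at hle
  have hzero : (Pi.single i κ - βs P) ⬝ᵥ (Pi.single i κ - βs P) = 0 := by
    have := dotProduct_self_nonneg_real (Pi.single i κ - βs P)
    have ha2 := pow_pos ha 2
    nlinarith [hnonneg (βs P)]
  exact (sub_eq_zero.1 (dotProduct_self_eq_zero.1 hzero)).symm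

/-- An estimate that misses the invariant feature `i` has an excess risk of at least `a² κ²`, and an
estimate that uses the feature `k` is not invariant. -/
lemma le_loss_hardFamily [Fintype E] (ha : 0 < a) (hη : 0 < η) (hτ : (0 : ℝ) < τ)
    (hik : i ≠ k) {e₁ : E} (he : e₁ ≠ e₀) {βs : EnvFamily E p → Fin p → ℝ}
    (hβs : βs (hardFamily a τ κ η e₀ i k) = Pi.single i κ) {b : Fin p → ℝ}
    (hb : b i = 0 ∨ b k ≠ 0) :
    ENNReal.ofReal (a ^ 2 * κ ^ 2) ≤ loss βs b (hardFamily a τ κ η e₀ i k) := by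
  rw [loss]
  split_ifs with h
  · rw [mem_invariantSets_hardFamily ha hη hτ hik he, notMem_supp] at h
    refine le_trans ?_ (le_iSup _ e₀)
    rw [hβs, risk_sub_risk_hardFamily hik e₀ h]
    refine ENNReal.ofReal_le_ofReal (mul_le_mul_of_nonneg_left ?_ (sq_nonneg a))
    have hi : (Pi.single i κ - b : Fin p → ℝ) i = κ := by simp [hb.resolve_right (not_not.2 h)]
    calc κ ^ 2 = (Pi.single i κ - b : Fin p → ℝ) i * (Pi.single i κ - b : Fin p → ℝ) i := by
          rw [hi, pow_two]
      _ ≤ _ := Finset.single_le_sum (fun j _ => mul_self_nonneg ((Pi.single i κ - b : Fin p → ℝ) j))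
          (Finset.mem_univ i)
  · exact le_top

lemma covMatrix_hardFamily (e : E) : covMatrix (hardFamily a τ κ η e₀ i k) e
    = algebraMap ℝ (Matrix (Fin p) (Fin p) ℝ) (a ^ 2) := by
  ext j l
  rw [covMatrix, Matrix.of_apply, hardFamily,
    integral_mixLaw_features (F := fun x => x j * x l) (by fun_prop), integral_signVec_mul,
    Matrix.algebraMap_matrix_apply]
  rfl

lemma pairCoef_dotProduct_self (hik : i ≠ k) (κ θ : ℝ) :
    pairCoef κ θ i k ⬝ᵥ pairCoef κ θ i k = κ ^ 2 + θ ^ 2 := by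
  rw [pairCoef, dotProduct_self_add_single (by simp [hik.symm])]
  simp [pow_two]

lemma memXi_hardFamily [Fintype E] (ha : 0 < a) (hκ : 0 < κ) (hη : 0 < η) (hηκ : η ≤ κ)
    (hτ : (0 : ℝ) < τ) (hik : i ≠ k) {e₁ : E} (he : e₁ ≠ e₀) {tr : Finset E} (h₀ : e₀ ∈ tr)
    (h₁ : e₁ ∈ tr) {βs : EnvFamily E p → Fin p → ℝ}
    (hβs : βs (hardFamily a τ κ η e₀ i k) = Pi.single i κ) {s : ℕ} (hs : 1 ≤ s) {ρ σ2 : ℝ}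
    (hρ : a ^ 2 * (4 * κ ^ 2) ≤ ρ) (hσ : a ^ 2 * η ^ 2 ≤ σ2) :
    MemXi tr βs s ρ σ2 (hardFamily a τ κ η e₀ i k) where
  memLp_x e j := memLp_two_mixLaw (by fun_prop)
  memLp_y e := memLp_two_mixLaw (by fun_prop)
  approx e := by
    classical
    set θ := if e = e₀ then κ + η else κ with hθ
    have hθ0 : 0 ≤ θ := by rw [hθ]; split_ifs <;> linarith
    have hθκ : θ ≤ 2 * κ := by rw [hθ]; split_ifs <;> linarith
    have hm : (1 - τ : ℝ) • pairCoef κ κ i k + (τ : ℝ) • pairCoef κ θ i k - Pi.single i κ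
        = Pi.single k ((1 - τ) * κ + τ * θ) := by
      simp only [pairCoef, Pi.single_add, ← smul_eq_mul, Pi.single_smul]
      module
    have hcalc : ∫ z, (((hardFamily a τ κ η e₀ i k e : Measure (Obs p))[fun z : Obs p => z.2 |
          featureAlg p]) z - z.1 ⬝ᵥ βs (hardFamily a τ κ η e₀ i k)) ^ 2
            ∂(hardFamily a τ κ η e₀ i k e : Measure (Obs p))
        = a ^ 2 * ((1 - τ) * κ + τ * θ) ^ 2 := by
      calc _ = ∫ z, (z.1 ⬝ᵥ Pi.single k ((1 - τ) * κ + τ * θ))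
              * (z.1 ⬝ᵥ Pi.single k ((1 - τ) * κ + τ * θ))
              ∂(hardFamily a τ κ η e₀ i k e : Measure (Obs p)) := by
            refine integral_congr_ae ?_
            filter_upwards [condExp_outcome (a := a) (τ := τ) (β := pairCoef κ κ i k)
              (γ := pairCoef κ θ i k)] with z hz
            rw [← hm, dotProduct_sub, hβs, ← hz, pow_two]
            rfl
        _ = _ := by
            rw [hardFamily, integral_features_mul_features]
            simp [pow_two]
    rw [hcalc]
    refine le_trans (mul_le_mul_of_nonneg_left ?_ (sq_nonneg a)) hρ
    have hτ1 : (τ : ℝ) ≤ 1 := τ.2.2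
    have hle : (1 - τ) * κ + τ * θ ≤ 2 * κ := by nlinarith
    have hnn : 0 ≤ (1 - τ) * κ + τ * θ := by nlinarith
    nlinarith
  condVar_le e := by
    classical
    refine condVar_outcome_le fun ω => ?_
    have hd : pairCoef κ (if e = e₀ then κ + η else κ) i k - pairCoef κ κ i k
        = Pi.single k (if e = e₀ then η else 0) := by
      split_ifs <;> simp [pairCoef, Pi.single_add]
    rw [hd, dotProduct_single, mul_pow]
    have hx : signVec a ω k ^ 2 = a ^ 2 := by
      unfold signVec
      split_ifs <;> ring
    rw [hx]
    refine le_trans (mul_le_mul_of_nonneg_left ?_ (sq_nonneg a)) hσ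
    split_ifs
    · exact le_rfl
    · simpa using sq_nonneg η
  diversity S hS := by
    rw [mem_invariantSets_hardFamily ha hη hτ hik he, not_not] at hS
    exact .inl (pos_iff_ne_zero.2 (crossGap_hardFamily_ne_zero ha hη hτ hik he h₀ h₁ hS))
  sparse := by
    rw [hβs]
    refine le_trans (Finset.card_le_card (t := {i}) fun j hj => ?_) (by simpa using hs)
    by_contra hji
    exact notMem_supp.2 (Pi.single_eq_of_ne (by simpa using hji) κ) hj

lemma modelCondition_hardFamily (hη : 0 < η) (hηκ : η ≤ κ) (hik : i ≠ k)
    {tr : Finset E} {c₁ c₂ c₃ : ℝ} {K : ℝ≥0} (hc₁ : a ^ 2 * (5 * κ ^ 2) ≤ c₁)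
    (hc₂ : c₂ ≤ a ^ 2) (hc₃ : a ^ 2 ≤ c₃) (haK : a ^ 2 ≤ K) (hK : a ^ 2 * (5 * κ ^ 2) ≤ K) :
    ModelCondition tr c₁ c₂ c₃ K (hardFamily a τ κ η e₀ i k) := by
  classical
  have hnorm : ∀ e : E, (pairCoef κ (if e = e₀ then κ + η else κ) i k) ⬝ᵥ
      (pairCoef κ (if e = e₀ then κ + η else κ) i k) ≤ 5 * κ ^ 2 := by
    intro e
    rw [pairCoef_dotProduct_self hik]
    split_ifs <;> nlinarith
  have hnorm' : (pairCoef κ κ i k) ⬝ᵥ (pairCoef κ κ i k) ≤ 5 * κ ^ 2 := by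
    rw [pairCoef_dotProduct_self hik]
    nlinarith [sq_nonneg κ]
  have : Nontrivial (Matrix (Fin p) (Fin p) ℝ) := have : Nonempty (Fin p) := ⟨i⟩; inferInstance
  refine ⟨fun e _ => ?_, fun e _ => ?_, fun e _ => ?_, fun e _ j => ?_, fun e _ v hv => ?_,
    fun e _ t ht => ?_, fun e t ht => ?_, fun e _ e' _ j => ?_⟩
  · rw [hardFamily, integral_mixLaw (F := fun z => z.2) measurable_snd]
    simp [linObs, integral_signVec_dotProduct]
  · exact hasSubgaussianMGF_outcome ((mul_le_mul_of_nonneg_left hnorm' (sq_nonneg a)).trans hK)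
      ((mul_le_mul_of_nonneg_left (hnorm e) (sq_nonneg a)).trans hK)
  · have h := integral_sq_residual (a := a) (τ := τ) (β := pairCoef κ κ i k)
      (γ := pairCoef κ (if e = e₀ then κ + η else κ) i k) 0
    simp only [dotProduct_zero, sub_zero] at h
    rw [hardFamily, h]
    refine le_trans (mul_le_mul_of_nonneg_left ?_ (sq_nonneg a)) hc₁
    have h1 := mul_le_mul_of_nonneg_left hnorm' (sub_nonneg.2 τ.2.2)
    have h2 := mul_le_mul_of_nonneg_left (hnorm e) τ.2.1
    linarith
  · rw [hardFamily, integral_mixLaw_features (F := fun x => x j) (by fun_prop), integral_signVec]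
  · exact hasSubgaussianMGF_features (by rwa [hv, mul_one])
  · rw [covMatrix_hardFamily, spectrum.scalar_eq, Set.mem_singleton_iff] at ht
    rwa [ht]
  · rw [covMatrix_hardFamily, spectrum.scalar_eq, Set.mem_singleton_iff] at ht
    rwa [ht]
  · rw [covMatrix_hardFamily, covMatrix_hardFamily]

/-- The law of the training data dominates a multiple of the law of uncontaminated data. -/
lemma smul_pi_linLaw_le_dataLaw (tr : Finset E) (n : E → ℕ) :
    ENNReal.ofReal (1 - τ) ^ (∑ e ∈ tr, n e) •
        (Measure.pi fun e : tr => Measure.pi fun _ : Fin (n e) => linLaw a (pairCoef κ κ i k))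
      ≤ dataLaw tr n (hardFamily a τ κ η e₀ i k) := by
  rw [← Finset.sum_coe_sort, ← Finset.prod_pow_eq_pow_sum]
  refine smul_pi_le_pi fun e => ?_
  have h := smul_pi_le_pi (ι := Fin (n e)) (r := fun _ => ENNReal.ofReal (1 - τ))
    fun _ => smul_linLaw_le_mixLaw (a := a) (τ := τ) (β := pairCoef κ κ i k)
      (γ := (pairCoef κ (open Classical in if (e : E) = e₀ then κ + η else κ) i k))
  simpa [hardFamily] using h

/-- A lower bound for the minimax risk in terms of the signal strength `κ`: the families in which
the roles of the features `i` and `k` are exchanged cannot be told apart. -/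
lemma le_minimaxRisk [Fintype E] {tr : Finset E} {n : E → ℕ} {α : E → ℝ}
    {βs : EnvFamily E p → Fin p → ℝ} {s : ℕ} {ρ σ2 c₁ c₂ c₃ : ℝ} {K : ℝ≥0}
    (htr : 2 ≤ tr.card) (hp : 2 ≤ p) (hα : ∑ e, α e = 1) (hβs : IsOracle α βs) (hs : 1 ≤ s)
    (hn : 0 < ∑ e ∈ tr, n e) (ha : 0 < a) (hκ : 0 < κ) (hσ : 0 < σ2)
    (hρ : a ^ 2 * (4 * κ ^ 2) ≤ ρ) (hc₁ : a ^ 2 * (5 * κ ^ 2) ≤ c₁)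
    (hc₂ : c₂ ≤ a ^ 2) (hc₃ : a ^ 2 ≤ c₃) (haK : a ^ 2 ≤ K) (hK : a ^ 2 * (5 * κ ^ 2) ≤ K) :
    ENNReal.ofReal (a ^ 2 * κ ^ 2 / 4) ≤ minimaxRisk tr n βs s ρ σ2 c₁ c₂ c₃ K := by
  obtain ⟨e₀, h₀, e₁, h₁, he⟩ := Finset.one_lt_card.1 htr
  obtain ⟨i, k, hik⟩ : ∃ i k : Fin p, i ≠ k :=
    ⟨⟨0, by omega⟩, ⟨1, by omega⟩, by simp⟩
  set N := ∑ e ∈ tr, n e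
  have hN : (1 : ℝ) ≤ N := by exact_mod_cast hn
  set η := min κ (√σ2 / a)
  have hη : 0 < η := lt_min hκ (div_pos (Real.sqrt_pos.2 hσ) ha)
  have hησ : a ^ 2 * η ^ 2 ≤ σ2 := by
    rw [← mul_pow]
    calc (a * η) ^ 2 ≤ (a * (√σ2 / a)) ^ 2 := by gcongr; exact min_le_right _ _
      _ = σ2 := by rw [mul_div_cancel₀ _ ha.ne', Real.sq_sqrt hσ.le]
  -- With contamination rate `1 / (2 N)` the whole sample is clean with probability at least `1 / 2`.
  have hτN : 1 / (2 * N : ℝ) ≤ 1 / 2 := by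
    rw [div_le_div_iff₀ (by positivity) two_pos]
    linarith
  let τ : unitInterval := ⟨1 / (2 * N), by positivity, by linarith⟩
  have hτ : (0 : ℝ) < τ := by change 0 < 1 / (2 * N : ℝ); positivity
  have hclean : ENNReal.ofReal (1 / 2) ≤ ENNReal.ofReal (1 - τ) ^ N := by
    rw [← ENNReal.ofReal_pow (sub_nonneg.2 τ.2.2)]
    refine ENNReal.ofReal_le_ofReal ?_
    have hB := one_add_mul_le_pow (a := -(τ : ℝ)) (by linarith [τ.2.2]) N
    have hmul : (N : ℝ) * τ = 1 / 2 := by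
      change (N : ℝ) * (1 / (2 * N)) = 1 / 2
      field_simp
    rw [← sub_eq_add_neg] at hB
    linarith
  have hclass : ∀ {i k : Fin p}, i ≠ k →
      βs (hardFamily a τ κ η e₀ i k) = Pi.single i κ ∧
      MemXi tr βs s ρ σ2 (hardFamily a τ κ η e₀ i k) ∧
        ModelCondition tr c₁ c₂ c₃ K (hardFamily a τ κ η e₀ i k) := by
    intro i k hik
    have ho := oracle_hardFamily (κ := κ) ha hη hτ hik he.symm hα hβs
    exact ⟨ho, memXi_hardFamily ha hκ hη (min_le_left _ _) hτ hik he.symm h₀ h₁ ho hs hρ hησ,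
      modelCondition_hardFamily hη (min_le_left _ _) hik hc₁ hc₂ hc₃ haK hK⟩
  refine le_iInf₂ fun βhat hmeas => ?_
  set R := ⨆ (P : EnvFamily E p) (_ : MemXi tr βs s ρ σ2 P ∧ ModelCondition tr c₁ c₂ c₃ K P),
    ∫⁻ D, loss βs (βhat D) P ∂(dataLaw tr n P)
  have hik' := hclass hik
  have hki' := hclass hik.symm
  -- An estimate `b` with `b i = 0` fails for the family with invariant feature `i`; one with
  -- `b i ≠ 0` fails for the family with invariant feature `k`.
  have hdom : ∀ i k : Fin p, ENNReal.ofReal (1 - τ) ^ N •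
        (Measure.pi fun e : tr => Measure.pi fun _ : Fin (n e) => linLaw a (pairCoef κ κ i k))
      ≤ dataLaw tr n (hardFamily a τ κ η e₀ i k) := fun i k => smul_pi_linLaw_le_dataLaw tr n
  have hlecam := mul_le_lintegral_add_lintegral
    (A := {D | βhat D i = 0}) (δ := ENNReal.ofReal (a ^ 2 * κ ^ 2))
    (f₁ := fun D => loss βs (βhat D) (hardFamily a τ κ η e₀ i k))
    (f₂ := fun D => loss βs (βhat D) (hardFamily a τ κ η e₀ k i))
    (hdom i k) (pairCoef_comm κ k i ▸ hdom k i)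
    (measurableSet_eq_fun ((measurable_pi_apply i).comp hmeas) measurable_const)
    (fun D hD => le_loss_hardFamily ha hη hτ hik he.symm hik'.1 (.inl hD))
    (fun D hD => le_loss_hardFamily ha hη hτ hik.symm he.symm hki'.1 (.inr hD))
  have hR : 2 * ENNReal.ofReal (a ^ 2 * κ ^ 2 / 4) ≤ 2 * R := by
    calc 2 * ENNReal.ofReal (a ^ 2 * κ ^ 2 / 4)
        = ENNReal.ofReal (1 / 2) * ENNReal.ofReal (a ^ 2 * κ ^ 2) := by
          rw [← ENNReal.ofReal_ofNat, ← ENNReal.ofReal_mul (by norm_num),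
            ← ENNReal.ofReal_mul (by norm_num)]
          congr 1
          ring
      _ ≤ _ := (mul_le_mul_left hclean _).trans hlecam
      _ ≤ R + R := add_le_add (le_iSup₂_of_le _ hik'.2 le_rfl) (le_iSup₂_of_le _ hki'.2 le_rfl)
      _ = 2 * R := (two_mul R).symm
  exact (ENNReal.mul_le_mul_iff_right (by norm_num) (by norm_num)).1 hR

end HardFamily

end Fairm

theorem mainTheorem2 (c₁ c₂ c₃ : ℝ) (K : ℝ≥0) (hc₁ : 0 < c₁) (hc₂ : 0 < c₂) (hc₃ : c₂ ≤ c₃)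
    (hK : c₂ ≤ (K : ℝ)) (c B : ℝ) (hc : 0 < c) (hB : 0 < B) :
    ∃ C : ℝ, 0 < C ∧
      ∀ (E : Type) [Fintype E] (tr : Finset E) (n : E → ℕ) (p s : ℕ) (α : E → ℝ) (ρ σ2 : ℝ)
        (βs : Fairm.EnvFamily E p → (Fin p → ℝ)),
        2 ≤ tr.card → 2 ≤ p →
        (∀ e, 0 ≤ α e) → ∑ e, α e = 1 → Fairm.IsOracle α βs →
        3 ≤ s → (s : ℝ) ≤ c * ((∑ e ∈ tr, n e : ℕ) : ℝ) / Real.log p →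
        1 ≤ ρ → 0 < σ2 → σ2 ≤ B →
        ENNReal.ofReal
            (C * (σ2 * s * Real.log p / ((∑ e ∈ tr, n e : ℕ) : ℝ))
              + C / Real.sqrt ((∑ e ∈ tr, n e : ℕ) : ℝ))
          ≤ Fairm.minimaxRisk tr n βs s ρ σ2 c₁ c₂ c₃ K := by
  set L : ℝ := min 1 (min K c₁) with hL
  have hK0 : (0 : ℝ) < K := hc₂.trans_le hK
  have hL0 : 0 < L := lt_min one_pos (lt_min hK0 hc₁)
  have hL1 : L ≤ 1 := min_le_left _ _
  have hLK : L ≤ K := (min_le_right _ _).trans (min_le_left _ _)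
  have hLc : L ≤ c₁ := (min_le_right _ _).trans (min_le_right _ _)
  have hBc : 0 < B * c + 1 := by positivity
  refine ⟨L / 32 / (B * c + 1), by positivity, ?_⟩
  intro E _ tr n p s α ρ σ2 βs htr hp _ hα hβs hs hsN hρ hσ hσB
  set N := ∑ e ∈ tr, n e
  have hlog : 0 < Real.log p := Real.log_pos (by exact_mod_cast hp)
  have hs0 : (0 : ℝ) < s := by exact_mod_cast (by omega : 0 < s)
  have hN : 0 < N := by
    rcases Nat.eq_zero_or_pos N with h | h
    · simp [h] at hsN
      linarith
    · exact h
  have hN1 : (1 : ℝ) ≤ N := by exact_mod_cast hN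
  have ha : 0 < √c₂ := Real.sqrt_pos.2 hc₂
  have ha2 : √c₂ ^ 2 = c₂ := Real.sq_sqrt hc₂.le
  have hκ2 : √c₂ ^ 2 * √(L / (8 * c₂)) ^ 2 = L / 8 := by
    rw [ha2, Real.sq_sqrt (by positivity)]
    field_simp
  -- The sparsity restriction and the bound on the noise level bound the target by a constant.
  have hrate : σ2 * s * Real.log p / N ≤ B * c := by
    rw [le_div_iff₀ hlog] at hsN
    rw [div_le_iff₀ (by positivity)]
    calc σ2 * s * Real.log p = σ2 * (s * Real.log p) := mul_assoc _ _ _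
      _ ≤ B * (c * N) := mul_le_mul hσB hsN (by positivity) hB.le
      _ = B * c * N := (mul_assoc _ _ _).symm
  have hsqrt : 1 / √(N : ℝ) ≤ 1 := by
    rw [div_le_one (by positivity)]
    exact Real.one_le_sqrt.2 hN1
  refine le_trans (ENNReal.ofReal_le_ofReal ?_) (Fairm.le_minimaxRisk (a := √c₂)
    (κ := √(L / (8 * c₂))) htr hp hα hβs (by omega) hN ha (Real.sqrt_pos.2 (by positivity)) hσ
    (by linarith) (by linarith) ha2.ge (ha2.trans_le hc₃) (ha2.trans_le hK) (by linarith))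
  calc L / 32 / (B * c + 1) * (σ2 * s * Real.log p / N) + L / 32 / (B * c + 1) / √(N : ℝ)
      = L / 32 / (B * c + 1) * (σ2 * s * Real.log p / N + 1 / √(N : ℝ)) := by ring
    _ ≤ L / 32 / (B * c + 1) * (B * c + 1) := by gcongr
    _ = L / 32 := div_mul_cancel₀ _ hBc.ne'
    _ = √c₂ ^ 2 * √(L / (8 * c₂)) ^ 2 / 4 := by rw [hκ2]; ring
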